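/- All graphs are finite, undirected, without loops or multiple edges. For a graph $G$ with vertex set $V(G)$ and edge set $E(G)$, a matching of $G$ is a set $M\subseteq E(G)$ no two distinct edges of which share an endpoint; $V(M)$ denotes the set of endpoints of the edges in $M$, $\mathcal{M}(G)$ the set of all matchings of $G$ (including $\varnothing$), and $d_G(v)$ the degree of the vertex $v$. The Laplacian matching polynomial of $G$ is $$LM(G,x)=\sum_{M\in\mathcal{M}(G)}(-1)^{|M|}\prod_{v\in V(G)\setminus V(M)}\bigl(x-d_G(v)\bigr).$$ Theorem. Let $G$ be a graph and let $n=|V(G)|$. (i) For each edge $e\in E(G)$, let $G-e$ be the graph on $V(G)$ obtained from $G$ by deleting $e$. Then $LM(G,x)$ and $LM(G-e,x)$ have degree $n$ and all their zeros are real, and if $\alpha_1\leq\cdots\leq\alpha_n$ and $\beta_1\leq\cdots\leq\beta_n$ are, respectively, the zeros of $LM(G,x)$ and of $LM(G-e,x)$, listed with multiplicity, then $$\beta_1\leq\alpha_1\leq\beta_2\leq\alpha_2\leq\cdots\leq\beta_n\leq\alpha_n.$$ (ii) If $G$ is connected, then for every proper subgraph $H$ of $G$ with at least one vertex (that is, $\varnothing\neq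 V(H)\subseteq V(G)$, $E(H)\subseteq E(G)$ and $H\neq G$), the polynomials $LM(G,x)$ and $LM(H,x)$ have only real zeros, and the largest zero of $LM(G,x)$ is strictly greater than the largest zero of $LM(H,x)$. -/

import Mathlib

/-- A matching of `G`: a set of edges of `G` no two distinct members of which share an endpoint. -/
def SimpleGraph.IsEdgeMatching {V : Type*} (G : SimpleGraph V) (M : Finset (Sym2 V)) : Prop :=
  (∀ e ∈ M, e ∈ G.edgeSet) ∧ ∀ e ∈ M, ∀ f ∈ M, e ≠ f → ∀ v : V, ¬ (v ∈ e ∧ v ∈ f)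

open Classical in
/-- The Laplacian matching polynomial
`LM(G, x) = ∑ M, (-1) ^ |M| * ∏ (x - d_G(v))`, where `M` runs over the matchings of `G` and, for
each `M`, `v` runs over the vertices that are not an endpoint of an edge in `M`. -/
noncomputable def SimpleGraph.laplacianMatchingPolynomial {V : Type*} [Fintype V]
    (G : SimpleGraph V) : Polynomial ℝ :=
  ∑ M : Finset (Sym2 V) with G.IsEdgeMatching M,
    (-1) ^ M.card *
      ∏ v : V with ∀ e ∈ M, v ∉ e, (Polynomial.X - Polynomial.C (G.degree v : ℝ))

/-- `p` has degree `n`, and all its `n` complex zeros, counted with multiplicity, are real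
and are `α 0 ≤ α 1 ≤ … ≤ α (n - 1)`. -/
def Polynomial.IsOrderedZeros {n : ℕ} (p : Polynomial ℝ) (α : Fin n → ℝ) : Prop :=
  p.natDegree = n ∧ Monotone α ∧ p.roots = Finset.univ.val.map α

/-- `p` is a nonzero real-rooted polynomial and `r` is its largest zero. -/
def Polynomial.IsLargestZero (p : Polynomial ℝ) (r : ℝ) : Prop :=
  p ≠ 0 ∧ p.Splits ∧ IsGreatest {x : ℝ | p.IsRoot x} r

/-!
Fix vertex weights `a` and let `P S` be the weighted matching polynomial of the subgraph induced on
`S`, so that the Laplacian matching polynomial is `P univ` for `a = degree`. Everything rests on the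
vertex recurrence `P S = (X - a v) P (S - v) - ∑ P (S - v - u)`, the sum running over the neighbours
`u` of `v` in `S` (`SimpleGraph.weightedMatchingPolynomial_recurrence`).

Dividing it by `P (S - v)`, one sees by induction that `P S / P (S - v)` maps the open upper
half-plane to itself, so that `P S` has only real zeros. If `e = uv` is an edge of `G` and
`H = G - e`, the recurrence also gives `LM(G) = LM(H) - P (V - u) - P (V - v)`, with the polynomials
on the right formed in `H` with the degrees of `H`
(`SimpleGraph.laplacianMatchingPolynomial_deleteEdges`). Therefore `LM(G) / LM(H)` has positive
imaginary part in the upper half-plane. The argument of this quotient is a difference of sums of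
arguments of linear factors; along a vertical half-line it tends to `0` at infinity, and it cannot
leave `(0, π)`. In the limit at a real point `x` it equals `π` times the number of zeros of `LM(G)`
beyond `x` minus the number of zeros of `LM(H)` beyond `x`, up to zeros at `x` itself. That this
difference is `0` or `1` for every `x` is the interlacing (`interlacing_of_div_im_pos`).

For the largest zeros, let `x₁` be the largest real zero of any `P S`. In a connected graph a
minimal `S` with `P S` vanishing at `x₁` is the whole vertex set, for otherwise the recurrence at a
vertex outside `S` adjacent to `S` would give a negative value at `x₁`. So `x₁` is the largest zero of
`P univ`, and the other `P S` are positive on `[x₁, ∞)`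
(`SimpleGraph.Connected.exists_isRoot_forall_pos`). On this ray, by the recurrence again, the
quotients `P S / P (S - v)` can only grow when vertices and edges are deleted and weights are
lowered (`SimpleGraph.div_add_weight_sub_le_div`), as happens in passing to a subgraph with its
own degrees.
If the subgraph is proper, either its vertex set is, or some degree drops by at least `1`; in both
cases its Laplacian matching polynomial is positive on `[x₁, ∞)`.
-/

open Polynomial

/-! ### Real-rooted polynomials -/

namespace Polynomial

/-- A real polynomial without zeros in the open upper half-plane splits. -/
theorem splits_of_aeval_ne_zero {p : ℝ[X]}
    (h : ∀ z : ℂ, 0 < z.im → aeval z p ≠ 0) : p.Splits := by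
  refine Splits.of_splits_map (algebraMap ℝ ℂ) (IsAlgClosed.splits _) fun z hz => ?_
  have hz' : aeval z p = 0 := by
    have := isRoot_of_mem_roots hz
    rwa [IsRoot, eval_map_algebraMap] at this
  have hconj : aeval (starRingEnd ℂ z) p = 0 := by
    rw [aeval_conj, hz', map_zero]
  have him : z.im = 0 := by
    rcases lt_trichotomy z.im 0 with h1 | h1 | h1
    · exact absurd hconj (h _ (by simpa using h1))
    · exact h1
    · exact absurd hz' (h _ h1)
  exact ⟨z.re, Complex.ext (by simp) (by simp [him])⟩

theorem Monic.exists_isOrderedZeros {p : ℝ[X]} (hm : p.Monic) (hs : p.Splits) {n : ℕ}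
    (hn : p.natDegree = n) :
    ∃ α : Fin n → ℝ, p.IsOrderedZeros α ∧ ∀ z : ℂ, aeval z p = ∏ i, (z - α i) := by
  have hlen : (p.roots.sort (· ≤ ·)).length = n := by
    rw [Multiset.length_sort, ← hs.natDegree_eq_card_roots, hn]
  subst hlen
  set l := p.roots.sort (· ≤ ·) with hl
  have hroots : p.roots = Finset.univ.val.map l.get := by
    rw [Fin.univ_val_map, List.ofFn_get, hl, Multiset.sort_eq]
  refine ⟨l.get, ⟨hn, ?_, hroots⟩, fun z => ?_⟩
  · exact (Multiset.pairwise_sort p.roots (· ≤ ·)).sortedLE.monotone_get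
  · have hp : p = ∏ i, (X - C (l.get i)) := by
      conv_lhs => rw [hs.eq_prod_roots_of_monic hm, hroots, Multiset.map_map]
      rfl
    conv_lhs => rw [hp, map_prod]
    simp

end Polynomial

/-! ### Weighted matching polynomials and the vertex recurrence -/

namespace SimpleGraph

theorem IsEdgeMatching.subset {V : Type*} {G : SimpleGraph V} {M N : Finset (Sym2 V)}
    (hM : G.IsEdgeMatching M) (h : N ⊆ M) : G.IsEdgeMatching N :=
  ⟨fun e he => hM.1 e (h he), fun e he f hf => hM.2 e (h he) f (h hf)⟩

variable {V W : Type*} [Fintype V] [Fintype W]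

open Classical in
/-- The matching polynomial of the subgraph of `G` induced on `S`, with weight `a v` at the vertex
`v`: the sum over the matchings `M` of `G` inside `S` of `(-1) ^ |M| * ∏ (X - a v)`, where `v` runs
over the vertices of `S` not covered by `M`. The weights do not change with `S`; so for
`a = G.degree` this is in general not the Laplacian matching polynomial of the induced subgraph. -/
noncomputable def weightedMatchingPolynomial (G : SimpleGraph V) (a : V → ℝ) (S : Finset V) :
    ℝ[X] :=
  ∑ M : Finset (Sym2 V) with G.IsEdgeMatching M ∧ ∀ e ∈ M, ∀ v ∈ e, v ∈ S,
    (-1) ^ M.card * ∏ v ∈ S with ∀ e ∈ M, v ∉ e, (X - C (a v))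

theorem laplacianMatchingPolynomial_eq (G : SimpleGraph V) [∀ v, Fintype (G.neighborSet v)] :
    G.laplacianMatchingPolynomial =
      G.weightedMatchingPolynomial (fun v => (G.degree v : ℝ)) Finset.univ := by
  classical
  unfold laplacianMatchingPolynomial weightedMatchingPolynomial
  refine Finset.sum_congr (by ext; simp) fun M _ => ?_
  congr 1
  refine Finset.prod_congr (by ext; simp) fun v _ => ?_
  congr!

@[simp]
theorem weightedMatchingPolynomial_empty (G : SimpleGraph V) (a : V → ℝ) :
    G.weightedMatchingPolynomial a ∅ = 1 := by
  classical
  unfold weightedMatchingPolynomial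
  rw [Finset.sum_eq_single ∅]
  · simp
  · intro M hM hne
    obtain ⟨e, he⟩ := Finset.nonempty_iff_ne_empty.2 hne
    have h := (Finset.mem_filter.1 hM).2.2 e he
    induction e with
    | h x y => exact absurd (h x (by simp)) (by simp)
  · intro h
    simp [IsEdgeMatching] at h

open Classical in
/-- The vertex recurrence: in a matching, either `v` is not covered or it is matched to a
neighbour. -/
theorem weightedMatchingPolynomial_recurrence (G : SimpleGraph V) (a : V → ℝ) {S : Finset V}
    {v : V} (hv : v ∈ S) :
    G.weightedMatchingPolynomial a S =
      (X - C (a v)) * G.weightedMatchingPolynomial a (S.erase v) -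
        ∑ u ∈ S.erase v with G.Adj v u,
          G.weightedMatchingPolynomial a ((S.erase v).erase u) := by
  conv_lhs => rw [weightedMatchingPolynomial]
  rw [← Finset.sum_filter_add_sum_filter_not _ (fun M : Finset (Sym2 V) => ∀ e ∈ M, v ∉ e),
    sub_eq_add_neg]
  congr 1
  · rw [weightedMatchingPolynomial, Finset.mul_sum]
    refine Finset.sum_congr ?_ ?_
    · ext M
      simp only [Finset.mem_filter, Finset.mem_univ, true_and, Finset.mem_erase]
      constructor
      · rintro ⟨⟨h1, h2⟩, h3⟩
        exact ⟨h1, fun e he w hw => ⟨fun hwv => h3 e he (hwv ▸ hw), h2 e he w hw⟩⟩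
      · rintro ⟨h1, h2⟩
        exact ⟨⟨h1, fun e he w hw => (h2 e he w hw).2⟩, fun e he hve => (h2 e he v hve).1 rfl⟩
    · intro M hM
      have hvM : ∀ e ∈ M, v ∉ e := fun e he hve => by
        have := (Finset.mem_filter.1 hM).2.2 e he v hve
        simp at this
      have : S.filter (fun w => ∀ e ∈ M, w ∉ e) =
          insert v ((S.erase v).filter (fun w => ∀ e ∈ M, w ∉ e)) := by
        rw [← Finset.insert_erase hv, Finset.filter_insert, if_pos hvM, Finset.insert_erase hv]
      rw [this, Finset.prod_insert (by simp)]
      ring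
  · simp only [weightedMatchingPolynomial]
    rw [← Finset.sum_neg_distrib]
    simp only [← Finset.sum_neg_distrib]
    rw [Finset.sum_sigma']
    symm
    have key : ∀ x ∈ ((S.erase v).filter (G.Adj v)).sigma (fun u =>
        (Finset.univ : Finset (Finset (Sym2 V))).filter (fun M => G.IsEdgeMatching M ∧
          ∀ e ∈ M, ∀ w ∈ e, w ∈ (S.erase v).erase u)),
        G.Adj v x.1 ∧ x.1 ∈ S ∧ G.IsEdgeMatching x.2 ∧ (∀ e ∈ x.2, v ∉ e) ∧
          (∀ e ∈ x.2, x.1 ∉ e) ∧ (∀ e ∈ x.2, ∀ w ∈ e, w ∈ S) := by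
      rintro ⟨u, M⟩ h
      simp only [Finset.mem_sigma, Finset.mem_filter, Finset.mem_univ, true_and,
        Finset.mem_erase] at h
      obtain ⟨⟨⟨h1, h2⟩, h3⟩, h4, h5⟩ := h
      exact ⟨h3, h2, h4, fun e he hve => (h5 e he v hve).2.1 rfl,
        fun e he hve => (h5 e he u hve).1 rfl, fun e he w hw => (h5 e he w hw).2.2⟩
    -- A matching that covers `v` is an edge `vu` together with a matching that avoids `v` and `u`.
    refine Finset.sum_bij (fun x _ => insert s(v, x.1) x.2) ?_ ?_ ?_ ?_
    · intro x hx
      obtain ⟨hadj, hxS, hM, hvM, huM, hMS⟩ := key x hx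
      simp only [Finset.mem_filter, Finset.mem_univ, true_and]
      refine ⟨⟨⟨?_, ?_⟩, ?_⟩, ?_⟩
      · intro e he
        rcases Finset.mem_insert.1 he with rfl | he
        · exact hadj
        · exact hM.1 e he
      · have aux : ∀ f ∈ x.2, ∀ w, w ∈ s(v, x.1) → w ∉ f := by
          intro f hf w hw hwf
          rcases Sym2.mem_iff.1 hw with rfl | rfl
          · exact hvM f hf hwf
          · exact huM f hf hwf
        intro e he f hf hef w hw
        rcases Finset.mem_insert.1 he with rfl | he <;> rcases Finset.mem_insert.1 hf with rfl | hf
        · exact hef rfl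
        · exact aux f hf w hw.1 hw.2
        · exact aux e he w hw.2 hw.1
        · exact hM.2 e he f hf hef w hw
      · intro e he w hw
        rcases Finset.mem_insert.1 he with rfl | he
        · rcases Sym2.mem_iff.1 hw with rfl | rfl
          exacts [hv, hxS]
        · exact hMS e he w hw
      · intro h
        exact h _ (Finset.mem_insert_self _ _) (by simp)
    · intro x hx y hy hxy
      obtain ⟨-, -, -, hvM, -, -⟩ := key x hx
      obtain ⟨-, -, -, hvN, -, -⟩ := key y hy
      obtain ⟨u, M⟩ := x
      obtain ⟨u', N⟩ := y
      dsimp only at hxy hvM hvN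
      have h1 : s(v, u) ∈ insert s(v, u') N := hxy ▸ Finset.mem_insert_self _ _
      have hu : u = u' := by
        rcases Finset.mem_insert.1 h1 with h | h
        · exact Sym2.congr_right.1 h
        · exact absurd (Sym2.mem_mk_left v u) (hvN _ h)
      subst hu
      have hM : s(v, u) ∉ M := fun h => hvM _ h (by simp)
      have hN : s(v, u) ∉ N := fun h => hvN _ h (by simp)
      have : M = N := by
        rw [← Finset.erase_insert hM, hxy, Finset.erase_insert hN]
      rw [this]
    · intro M hM
      simp only [Finset.mem_filter, Finset.mem_univ, true_and, not_forall, not_not] at hM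
      obtain ⟨⟨hM, hMS⟩, e, he, hve⟩ := hM
      obtain ⟨u, rfl⟩ := hve
      have hadj : G.Adj v u := hM.1 _ he
      refine ⟨⟨u, M.erase s(v, u)⟩, ?_, Finset.insert_erase he⟩
      simp only [Finset.mem_sigma, Finset.mem_filter, Finset.mem_univ, true_and, Finset.mem_erase]
      refine ⟨⟨⟨hadj.ne', hMS _ he u (by simp)⟩, hadj⟩, hM.subset (Finset.erase_subset _ _), ?_⟩
      rintro f ⟨hf, hfM⟩ w hw
      refine ⟨?_, ?_, hMS f hfM w hw⟩
      · rintro rfl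
        exact hM.2 f hfM _ he hf w ⟨hw, by simp⟩
      · rintro rfl
        exact hM.2 f hfM _ he hf w ⟨hw, by simp⟩
    · intro x hx
      obtain ⟨hadj, hxS, hM, hvM, huM, hMS⟩ := key x hx
      have h1 : s(v, x.1) ∉ x.2 := fun h => hvM _ h (by simp)
      rw [Finset.card_insert_of_notMem h1, pow_succ, mul_neg_one, neg_mul]
      congr 2
      refine Finset.prod_congr ?_ fun _ _ => rfl
      ext w
      simp only [Finset.mem_filter, Finset.mem_erase, Finset.mem_insert, forall_eq_or_imp,
        Sym2.mem_iff, not_or]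
      tauto

/-- The polynomial only depends on the weights on `S` and on the edges inside `S`. -/
theorem weightedMatchingPolynomial_congr {G H : SimpleGraph V} {a b : V → ℝ} {S : Finset V}
    (hG : ∀ u ∈ S, ∀ v ∈ S, G.Adj u v ↔ H.Adj u v) (ha : ∀ v ∈ S, a v = b v) :
    G.weightedMatchingPolynomial a S = H.weightedMatchingPolynomial b S := by
  classical
  have aux : ∀ {G H : SimpleGraph V}, (∀ u ∈ S, ∀ v ∈ S, G.Adj u v ↔ H.Adj u v) →
      ∀ M : Finset (Sym2 V), (∀ e ∈ M, ∀ v ∈ e, v ∈ S) → G.IsEdgeMatching M →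
        H.IsEdgeMatching M := by
    intro G H hG M hS hM
    refine ⟨fun e he => ?_, hM.2⟩
    have h1 := hS e he
    have h2 := hM.1 e he
    induction e with
    | h x y => exact (hG x (h1 x (by simp)) y (h1 y (by simp))).1 h2
  unfold weightedMatchingPolynomial
  refine Finset.sum_congr ?_ fun M _ => ?_
  · ext M
    simp only [Finset.mem_filter, Finset.mem_univ, true_and]
    exact ⟨fun h => ⟨aux hG M h.2 h.1, h.2⟩,
      fun h => ⟨aux (fun u hu v hv => (hG u hu v hv).symm) M h.2 h.1, h.2⟩⟩
  · congr 1
    refine Finset.prod_congr rfl fun v hv => ?_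
    rw [ha v (Finset.mem_filter.1 hv).1]

theorem weightedMatchingPolynomial_monic_and_natDegree (G : SimpleGraph V) (a : V → ℝ)
    (S : Finset V) : (G.weightedMatchingPolynomial a S).Monic ∧
      (G.weightedMatchingPolynomial a S).natDegree = S.card := by
  classical
  induction S using Finset.strongInduction with
  | H S ih =>
    rcases S.eq_empty_or_nonempty with rfl | ⟨v, hv⟩
    · simp
    · obtain ⟨hm, hd⟩ := ih _ (Finset.erase_ssubset hv)
      have hm' := (monic_X_sub_C (a v)).mul hm
      have hd' : ((X - C (a v)) * G.weightedMatchingPolynomial a (S.erase v)).natDegree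
          = S.card := by
        rw [(monic_X_sub_C (a v)).natDegree_mul hm, hd, natDegree_X_sub_C, add_comm,
          Finset.card_erase_add_one hv]
      have hlt : (∑ u ∈ S.erase v with G.Adj v u,
          G.weightedMatchingPolynomial a ((S.erase v).erase u)).degree <
          ((X - C (a v)) * G.weightedMatchingPolynomial a (S.erase v)).degree := by
        rw [degree_eq_natDegree hm'.ne_zero, hd']
        refine (degree_sum_le _ _).trans_lt ?_
        rw [Finset.sup_lt_iff (WithBot.bot_lt_coe _)]
        intro u hu
        have hu' := (Finset.mem_filter.1 hu).1
        obtain ⟨h1, h2⟩ := ih ((S.erase v).erase u)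
          ((Finset.erase_ssubset hu').trans (Finset.erase_ssubset hv))
        rw [degree_eq_natDegree h1.ne_zero, h2]
        exact_mod_cast Finset.card_lt_card
          ((Finset.erase_ssubset hu').trans (Finset.erase_ssubset hv))
      rw [weightedMatchingPolynomial_recurrence G a hv]
      exact ⟨hm'.sub_of_left hlt, (natDegree_sub_eq_left_of_natDegree_lt
        (by
          by_cases h0 : (∑ u ∈ S.erase v with G.Adj v u,
            G.weightedMatchingPolynomial a ((S.erase v).erase u)) = 0
          · rw [h0, hd', natDegree_zero]
            exact Finset.card_pos.2 ⟨v, hv⟩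
          · exact natDegree_lt_natDegree h0 hlt)).trans hd'⟩

theorem weightedMatchingPolynomial_monic (G : SimpleGraph V) (a : V → ℝ) (S : Finset V) :
    (G.weightedMatchingPolynomial a S).Monic :=
  (G.weightedMatchingPolynomial_monic_and_natDegree a S).1

theorem natDegree_weightedMatchingPolynomial (G : SimpleGraph V) (a : V → ℝ) (S : Finset V) :
    (G.weightedMatchingPolynomial a S).natDegree = S.card :=
  (G.weightedMatchingPolynomial_monic_and_natDegree a S).2

/-! ### Real-rootedness -/

open Classical in
/-- The Heilmann–Lieb argument: dividing the vertex recurrence by the polynomial of `S.erase v`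
gives `z - a v` minus inverses of quotients of the same kind, and these inverses have negative
imaginary part by induction. -/
theorem aeval_weightedMatchingPolynomial_ne_zero_and_div_im_pos (G : SimpleGraph V) (a : V → ℝ)
    {z : ℂ} (hz : 0 < z.im) (S : Finset V) :
    aeval z (G.weightedMatchingPolynomial a S) ≠ 0 ∧ ∀ v ∈ S,
      0 < (aeval z (G.weightedMatchingPolynomial a S) /
        aeval z (G.weightedMatchingPolynomial a (S.erase v))).im := by
  induction S using Finset.strongInduction with
  | H S ih =>
    have main : ∀ v ∈ S, 0 < (aeval z (G.weightedMatchingPolynomial a S) /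
        aeval z (G.weightedMatchingPolynomial a (S.erase v))).im := by
      intro v hv
      obtain ⟨h0, hdiv⟩ := ih _ (Finset.erase_ssubset hv)
      rw [weightedMatchingPolynomial_recurrence G a hv, map_sub, map_mul, sub_div,
        mul_div_cancel_right₀ _ h0, map_sum, Finset.sum_div, Complex.sub_im, Complex.im_sum]
      have h1 : (aeval z (X - C (a v) : ℝ[X])).im = z.im := by simp
      have h2 : ∑ u ∈ S.erase v with G.Adj v u,
          (aeval z (G.weightedMatchingPolynomial a ((S.erase v).erase u)) /
            aeval z (G.weightedMatchingPolynomial a (S.erase v))).im ≤ 0 := by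
        refine Finset.sum_nonpos fun u hu => ?_
        have h3 := hdiv u (Finset.mem_filter.1 hu).1
        rw [← inv_div, Complex.inv_im]
        exact div_nonpos_of_nonpos_of_nonneg (by linarith) (Complex.normSq_nonneg _)
      linarith
    refine ⟨?_, main⟩
    rcases S.eq_empty_or_nonempty with rfl | ⟨v, hv⟩
    · simp
    · intro h
      have := main v hv
      simp [h] at this

theorem weightedMatchingPolynomial_splits (G : SimpleGraph V) (a : V → ℝ) (S : Finset V) :
    (G.weightedMatchingPolynomial a S).Splits :=
  Polynomial.splits_of_aeval_ne_zero fun _ hz =>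
    (G.aeval_weightedMatchingPolynomial_ne_zero_and_div_im_pos a hz S).1

/-! ### Deleting an edge -/

open Classical in
/-- Only matchings containing the edge `uv` are lost when it is deleted. -/
theorem weightedMatchingPolynomial_deleteEdges {G H : SimpleGraph V} (a : V → ℝ) {S : Finset V}
    {u v : V} (hu : u ∈ S) (hv : v ∈ S) (h : G.Adj u v) (hH : H = G.deleteEdges {s(u, v)}) :
    G.weightedMatchingPolynomial a S = H.weightedMatchingPolynomial a S -
      H.weightedMatchingPolynomial a ((S.erase u).erase v) := by
  have hadj : ∀ x y, x ≠ u → y ≠ u → (G.Adj x y ↔ H.Adj x y) := by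
    intro x y hx hy
    simp [hH, deleteEdges_adj, hx, hy]
  have hcongr : ∀ T : Finset V, u ∉ T → G.weightedMatchingPolynomial a T =
      H.weightedMatchingPolynomial a T := fun T hT =>
    weightedMatchingPolynomial_congr (fun x hx y hy => hadj x y (fun e => hT (e ▸ hx))
      (fun e => hT (e ▸ hy))) fun _ _ => rfl
  -- In the recurrence at `u`, the edge only contributes the term of the neighbour `v`.
  have hset : (S.erase u).filter (G.Adj u) =
      insert v ((S.erase u).filter (H.Adj u)) := by
    ext w
    by_cases hw : w = v
    · subst hw
      simp [h, hv, h.ne']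
    · simp only [hH, Finset.mem_filter, Finset.mem_insert, hw, false_or, deleteEdges_adj,
        Set.mem_singleton_iff, Sym2.congr_right, not_false_eq_true, and_true]
  rw [weightedMatchingPolynomial_recurrence G a hu,
    weightedMatchingPolynomial_recurrence H a hu, hset,
    Finset.sum_insert (by simp [hH]), hcongr _ (by simp), hcongr _ (by simp),
    Finset.sum_congr rfl fun w _ => hcongr ((S.erase u).erase w) (by simp)]
  ring

open Classical in
/-- The weight of `v` only enters the recurrence at `v` through its first term. -/
theorem weightedMatchingPolynomial_add_single (G : SimpleGraph V) (a : V → ℝ) {S : Finset V}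
    {v : V} (hv : v ∈ S) (t : ℝ) :
    G.weightedMatchingPolynomial (a + Pi.single v t) S = G.weightedMatchingPolynomial a S -
      C t * G.weightedMatchingPolynomial a (S.erase v) := by
  have hcongr : ∀ T : Finset V, v ∉ T → G.weightedMatchingPolynomial (a + Pi.single v t) T =
      G.weightedMatchingPolynomial a T := fun T hT =>
    weightedMatchingPolynomial_congr (fun _ _ _ _ => Iff.rfl) fun w hw => by
      have : w ≠ v := fun e => hT (e ▸ hw)
      simp [this]
  rw [weightedMatchingPolynomial_recurrence G _ hv, weightedMatchingPolynomial_recurrence G a hv,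
    hcongr _ (by simp), Finset.sum_congr rfl fun w _ => hcongr ((S.erase v).erase w) (by simp)]
  simp only [Pi.add_apply, Pi.single_eq_same, map_add]
  ring

open Classical in
/-- Deleting an edge changes the matchings and the degrees; the terms in which both ends of the
edge are removed cancel. -/
theorem laplacianMatchingPolynomial_deleteEdges {G H : SimpleGraph V} {u v : V} (h : G.Adj u v)
    (hH : H = G.deleteEdges {s(u, v)}) :
    G.laplacianMatchingPolynomial = H.laplacianMatchingPolynomial -
      H.weightedMatchingPolynomial (fun w => (H.degree w : ℝ)) (Finset.univ.erase u) -
      H.weightedMatchingPolynomial (fun w => (H.degree w : ℝ)) (Finset.univ.erase v) := by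
  set a : V → ℝ := fun w => (H.degree w : ℝ) with ha
  -- Only the degrees of the two ends of the edge change.
  have hdeg : (fun w => (G.degree w : ℝ)) = a + Pi.single v 1 + Pi.single u 1 := by
    have hadj : ∀ x y, H.Adj x y ↔ G.Adj x y ∧ s(x, y) ≠ s(u, v) := fun x y => by
      simp [hH, deleteEdges_adj]
    have key : ∀ x y, G.Adj x y → s(x, y) = s(u, v) → (G.degree x : ℝ) = H.degree x + 1 := by
      intro x y hxy he
      have : G.neighborFinset x = insert y (H.neighborFinset x) := by
        ext w
        simp only [mem_neighborFinset, Finset.mem_insert, hadj, ← he, ne_eq, Sym2.congr_right]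
        by_cases hw : w = y
        · simp [hw, hxy]
        · simp [hw]
      rw [← card_neighborFinset_eq_degree, this, Finset.card_insert_of_notMem (by simp [hadj, he]),
        card_neighborFinset_eq_degree]
      push_cast
      rfl
    funext w
    by_cases hwu : w = u
    · subst hwu
      simp [ha, key w v h rfl, h.ne]
    · by_cases hwv : w = v
      · subst hwv
        simp [ha, key w u h.symm Sym2.eq_swap, h.ne']
      · have : G.neighborFinset w = H.neighborFinset w := by
          ext x
          simp [hadj, hwu, hwv]
        simp only [Pi.add_apply, Pi.single_eq_of_ne hwu, Pi.single_eq_of_ne hwv, add_zero, ha,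
          ← card_neighborFinset_eq_degree, this]
  have hvu : v ∈ (Finset.univ : Finset V).erase u := by simp [h.ne']
  rw [laplacianMatchingPolynomial_eq G, laplacianMatchingPolynomial_eq H, hdeg,
    weightedMatchingPolynomial_deleteEdges _ (Finset.mem_univ u) (Finset.mem_univ v) h hH,
    weightedMatchingPolynomial_add_single H _ (Finset.mem_univ u),
    weightedMatchingPolynomial_add_single H _ (Finset.mem_univ v),
    weightedMatchingPolynomial_add_single H _ hvu,
    weightedMatchingPolynomial_congr (a := a + Pi.single v 1 + Pi.single u 1) (b := a)
      (S := (Finset.univ.erase u).erase v)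
      (fun _ _ _ _ => Iff.rfl) fun w hw => by
        simp only [Finset.mem_erase] at hw
        simp [hw.1, hw.2.1]]
  simp only [map_one, one_mul]
  ring

theorem laplacianMatchingPolynomial_monic (G : SimpleGraph V) :
    G.laplacianMatchingPolynomial.Monic := by
  classical
  exact G.laplacianMatchingPolynomial_eq ▸ G.weightedMatchingPolynomial_monic _ _

theorem natDegree_laplacianMatchingPolynomial (G : SimpleGraph V) :
    G.laplacianMatchingPolynomial.natDegree = Fintype.card V := by
  classical
  rw [G.laplacianMatchingPolynomial_eq, natDegree_weightedMatchingPolynomial, Finset.card_univ]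

theorem laplacianMatchingPolynomial_splits (G : SimpleGraph V) :
    G.laplacianMatchingPolynomial.Splits := by
  classical
  exact G.laplacianMatchingPolynomial_eq ▸ G.weightedMatchingPolynomial_splits _ _

/-- By the edge formula, the quotient is `1` minus two quotients whose imaginary part is negative in
the upper half-plane. -/
theorem laplacianMatchingPolynomial_div_deleteEdges_im_pos (G : SimpleGraph V) {e : Sym2 V}
    (he : e ∈ G.edgeSet) {z : ℂ} (hz : 0 < z.im) :
    0 < (aeval z G.laplacianMatchingPolynomial /
      aeval z (G.deleteEdges {e}).laplacianMatchingPolynomial).im := by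
  classical
  induction e with
  | h u v =>
    obtain ⟨H, hH⟩ : ∃ H, H = G.deleteEdges {s(u, v)} := ⟨_, rfl⟩
    obtain ⟨h0, hdiv⟩ := H.aeval_weightedMatchingPolynomial_ne_zero_and_div_im_pos
      (fun w => (H.degree w : ℝ)) hz Finset.univ
    rw [← hH, laplacianMatchingPolynomial_deleteEdges he hH, laplacianMatchingPolynomial_eq H,
      map_sub, map_sub, sub_div, sub_div, div_self h0]
    have key : ∀ w, (aeval z (H.weightedMatchingPolynomial (fun w => (H.degree w : ℝ))
        (Finset.univ.erase w)) / aeval z (H.weightedMatchingPolynomial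
          (fun w => (H.degree w : ℝ)) Finset.univ)).im < 0 := by
      intro w
      have h3 := hdiv w (Finset.mem_univ w)
      have h4 : aeval z (H.weightedMatchingPolynomial (fun w => (H.degree w : ℝ)) Finset.univ) /
          aeval z (H.weightedMatchingPolynomial (fun w => (H.degree w : ℝ))
            (Finset.univ.erase w)) ≠ 0 := fun h => by simp [h] at h3
      rw [← inv_div, Complex.inv_im]
      exact div_neg_of_neg_of_pos (by linarith) (Complex.normSq_pos.2 h4)
    have hu := key u
    have hv := key v
    simp only [Complex.sub_im, Complex.one_im]
    linarith

end SimpleGraph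

/-! ### Interlacing from arguments in the upper half-plane -/

section Interlacing

open Filter Topology Real

namespace Complex

theorem arg_add_mul_I_eq_arccos (t : ℝ) {y : ℝ} (hy : 0 < y) :
    arg (t + y * I) = arccos (t / ‖(t + y * I : ℂ)‖) := by
  have h : (t + y * I : ℂ) ≠ 0 := fun h => hy.ne' (by simpa using congrArg im h)
  rw [arg_of_im_nonneg_of_ne_zero (by simpa using hy.le) h]
  simp

theorem tendsto_arg_add_mul_I_nhdsGT_zero (t : ℝ) :
    Tendsto (fun y : ℝ => arg (t + y * I)) (𝓝[>] 0) (𝓝 (arccos (t / |t|))) := by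
  have : Tendsto (fun y : ℝ => arccos (t / ‖(t + y * I : ℂ)‖)) (𝓝[>] 0)
      (𝓝 (arccos (t / |t|))) := by
    refine continuous_arccos.continuousAt.tendsto.comp ?_
    rcases eq_or_ne t 0 with rfl | ht
    · simp
    · have hc : ContinuousAt (fun y : ℝ => t / ‖(t + y * I : ℂ)‖) 0 := by
        refine ContinuousAt.div continuousAt_const (by fun_prop) ?_
        simpa using ht
      have := hc.tendsto.mono_left (nhdsWithin_le_nhds (s := Set.Ioi 0))
      simpa using this
  refine this.congr' ?_
  filter_upwards [self_mem_nhdsWithin] with y hy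
  exact (arg_add_mul_I_eq_arccos t hy).symm

theorem tendsto_arg_add_mul_I_atTop (t : ℝ) :
    Tendsto (fun y : ℝ => arg (t + y * I)) atTop (𝓝 (π / 2)) := by
  have : Tendsto (fun y : ℝ => arccos (t / ‖(t + y * I : ℂ)‖)) atTop (𝓝 (π / 2)) := by
    rw [← arccos_zero]
    refine continuous_arccos.continuousAt.tendsto.comp ?_
    refine Tendsto.div_atTop tendsto_const_nhds ?_
    refine tendsto_atTop_mono (fun y => ?_) tendsto_id
    have := abs_im_le_norm (t + y * I : ℂ)
    simp only [add_im, ofReal_im, mul_im, ofReal_re, I_im, I_re, mul_one, mul_zero, zero_add,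
      add_zero] at this
    exact (le_abs_self y).trans this
  refine this.congr' ?_
  filter_upwards [eventually_gt_atTop 0] with y hy
  exact (arg_add_mul_I_eq_arccos t hy).symm

theorem continuousOn_arg_add_mul_I (t : ℝ) :
    ContinuousOn (fun y : ℝ => arg (t + y * I)) (Set.Ioi 0) := by
  intro y hy
  refine ContinuousAt.continuousWithinAt (ContinuousAt.comp
    (f := fun y : ℝ => (t + y * I : ℂ)) (continuousAt_arg ?_) (by fun_prop))
  exact Or.inr (by simpa using (ne_of_gt hy))

theorem prod_eq_norm_mul_exp_sum_arg {ι : Type*} (s : Finset ι) (f : ι → ℂ) :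
    ∏ i ∈ s, f i = ((∏ i ∈ s, ‖f i‖ : ℝ) : ℂ) * exp ((∑ i ∈ s, arg (f i) : ℝ) * I) := by
  push_cast
  rw [Finset.sum_mul, exp_sum, ← Finset.prod_mul_distrib]
  exact Finset.prod_congr rfl fun i _ => (norm_mul_exp_arg_mul_I _).symm

/-- The imaginary part of the quotient is a positive multiple of the sine of the difference of the
sums of arguments. So this difference, which tends to `0` at infinity along a vertical half-line,
never meets `0` or `π`. -/
theorem sum_arg_sub_sum_arg_mem_Ioo {ι : Type*} [Fintype ι] {α β : ι → ℝ}
    (h : ∀ z : ℂ, 0 < z.im → 0 < ((∏ i, (z - α i)) / ∏ i, (z - β i)).im) (x : ℝ) {y : ℝ}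
    (hy : 0 < y) :
    ∑ i, (arg ((x - α i : ℝ) + y * I) - arg ((x - β i : ℝ) + y * I)) ∈ Set.Ioo 0 π := by
  set S : ℝ → ℝ := fun y =>
    ∑ i, (arg ((x - α i : ℝ) + y * I) - arg ((x - β i : ℝ) + y * I)) with hS
  have hsin : ∀ y, 0 < y → 0 < Real.sin (S y) := by
    intro y hy
    have h1 := h (x + y * I) (by simpa using hy)
    have h2 : ∀ γ : ι → ℝ, ∏ i, ((x + y * I : ℂ) - γ i) = ∏ i, ((x - γ i : ℝ) + y * I : ℂ) :=
      fun γ => Finset.prod_congr rfl fun i _ => by push_cast; ring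
    rw [h2, h2, prod_eq_norm_mul_exp_sum_arg, prod_eq_norm_mul_exp_sum_arg Finset.univ,
      mul_div_mul_comm, ← exp_sub, ← sub_mul, ← ofReal_sub, ← Finset.sum_sub_distrib, ← ofReal_div,
      im_ofReal_mul, exp_ofReal_mul_I_im] at h1
    refine pos_of_mul_pos_right h1 ?_
    exact div_nonneg (Finset.prod_nonneg fun _ _ => norm_nonneg _)
      (Finset.prod_nonneg fun _ _ => norm_nonneg _)
  have hcont : ContinuousOn S (Set.Ioi 0) :=
    continuousOn_finsetSum _ fun i _ =>
      (continuousOn_arg_add_mul_I _).sub (continuousOn_arg_add_mul_I _)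
  have hlim : Tendsto S atTop (𝓝 0) := by
    have := tendsto_finsetSum (Finset.univ : Finset ι) fun i _ =>
      (tendsto_arg_add_mul_I_atTop (x - α i)).sub (tendsto_arg_add_mul_I_atTop (x - β i))
    simpa only [sub_self, Finset.sum_const_zero] using this
  obtain ⟨Y, hY, hYpos⟩ : ∃ Y, S Y ∈ Set.Ioo 0 π ∧ 0 < Y := by
    have hev := (hlim.eventually (Ioo_mem_nhds (neg_lt_zero.2 pi_pos) pi_pos)).and
      (eventually_gt_atTop 0)
    obtain ⟨Y, hY, hYpos⟩ := hev.exists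
    refine ⟨Y, ⟨?_, hY.2⟩, hYpos⟩
    by_contra! hle
    exact (hsin Y hYpos).not_ge (Real.sin_nonpos_of_nonpos_of_neg_pi_le hle hY.1.le)
  constructor
  · by_contra! hle
    obtain ⟨c, hc, hc0⟩ := isPreconnected_Ioi.intermediate_value hy hYpos hcont ⟨hle, hY.1.le⟩
    simpa [hc0] using hsin c hc
  · by_contra! hle
    obtain ⟨c, hc, hc0⟩ := isPreconnected_Ioi.intermediate_value hYpos hy hcont ⟨hY.2.le, hle⟩
    simpa [hc0] using hsin c hc

end Complex

open Complex in
/-- As `z` approaches the real point `x` from the upper half-plane, the argument of `z - a` tends to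
`π` if `x < a` and to `0` if `a < x`. So, for `x` not among the zeros, the difference of the sums of
arguments counts, in units of `π`, how many more `α i` than `β i` exceed `x`, and this number can
only be `0` or `1`. -/
theorem interlacing_of_div_im_pos {n : ℕ} {α β : Fin n → ℝ} (hα : Monotone α) (hβ : Monotone β)
    (h : ∀ z : ℂ, 0 < z.im → 0 < ((∏ i, (z - α i)) / ∏ i, (z - β i)).im) :
    (∀ i, β i ≤ α i) ∧ ∀ i j : Fin n, (i : ℕ) + 1 = j → α i ≤ β j := by
  -- `ω t` is the limit of the argument of `t + y * I` as `y` tends to `0` from above.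
  set ω : ℝ → ℝ := fun t => arccos (t / |t|) with hω
  have hω0 : ∀ t, 0 ≤ ω t := fun t => arccos_nonneg _
  have hωπ : ∀ t, ω t ≤ π := fun t => arccos_le_pi _
  have hpos : ∀ {t}, 0 < t → ω t = 0 := fun {t} ht => by
    simp [hω, abs_of_pos ht, ht.ne']
  have hneg : ∀ {t}, t < 0 → ω t = π := fun {t} ht => by
    simp [hω, abs_of_neg ht, ht.ne]
  have hlim : ∀ x : ℝ, ∑ i, (ω (x - α i) - ω (x - β i)) ∈ Set.Icc 0 π := by
    intro x
    have ht := tendsto_finsetSum (Finset.univ : Finset (Fin n)) fun i _ =>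
      (tendsto_arg_add_mul_I_nhdsGT_zero (x - α i)).sub
        (tendsto_arg_add_mul_I_nhdsGT_zero (x - β i))
    refine isClosed_Icc.mem_of_tendsto ht ?_
    filter_upwards [self_mem_nhdsWithin] with y hy
    exact Set.Ioo_subset_Icc_self (sum_arg_sub_sum_arg_mem_Ioo h x hy)
  constructor
  · intro i
    by_contra! hlt
    obtain ⟨x, hx1, hx2⟩ := exists_between hlt
    refine (hlim x).1.not_gt (Finset.sum_neg' (fun k _ => ?_) ⟨i, Finset.mem_univ _, ?_⟩)
    · rcases le_total k i with hk | hk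
      · rw [hpos (by linarith [hα hk])]
        linarith [hω0 (x - β k)]
      · rw [hneg (t := x - β k) (by linarith [hβ hk])]
        linarith [hωπ (x - α k)]
    · rw [hpos (by linarith), hneg (by linarith)]
      linarith [pi_pos]
  · intro i j hij
    by_contra! hlt
    obtain ⟨x, hx1, hx2⟩ := exists_between hlt
    -- All `α k` with `i ≤ k` exceed `x`, while no `β k` with `k ≤ j` does, which leaves at least
    -- two more of the `α k` than of the `β k` beyond `x`.
    have h1 : ∑ k, (if k ∈ Finset.Ici i then π else 0) ≤ ∑ k, ω (x - α k) := by
      refine Finset.sum_le_sum fun k _ => ?_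
      split_ifs with hk
      · rw [hneg (by linarith [hα (Finset.mem_Ici.1 hk)])]
      · exact hω0 _
    have h2 : ∑ k, ω (x - β k) ≤ ∑ k, (if k ∈ Finset.Ioi j then π else 0) := by
      refine Finset.sum_le_sum fun k _ => ?_
      split_ifs with hk
      · exact hωπ _
      · rw [hpos (by linarith [hβ (not_lt.1 (Finset.mem_Ioi.not.1 hk))])]
    rw [Finset.sum_ite_mem, Finset.univ_inter, Finset.sum_const, Fin.card_Ici, nsmul_eq_mul] at h1
    rw [Finset.sum_ite_mem, Finset.univ_inter, Finset.sum_const, Fin.card_Ioi, nsmul_eq_mul] at h2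
    have h3 := (hlim x).2
    rw [Finset.sum_sub_distrib] at h3
    have h4 : ((n - (i : ℕ) : ℕ) : ℝ) = ((n - 1 - (j : ℕ) : ℕ) : ℝ) + 2 := by
      have := j.2
      exact_mod_cast (by omega : n - (i : ℕ) = n - 1 - j + 2)
    rw [h4] at h1
    nlinarith [pi_pos]

end Interlacing

/-! ### The largest zero and comparison with subgraphs -/

namespace SimpleGraph

theorem Subgraph.degree_lt_of_adj_of_not_adj {V : Type*} {G : SimpleGraph V} (H : G.Subgraph)
    {u w : V} [Fintype (H.neighborSet u)] [Fintype (G.neighborSet u)] (hG : G.Adj u w)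
    (hH : ¬ H.Adj u w) : H.degree u < G.degree u := by
  have hs : H.neighborSet u ⊂ G.neighborSet u :=
    ⟨H.neighborSet_subset u, fun h => hH (h hG)⟩
  rw [← card_neighborSet_eq_degree]
  exact Set.card_lt_card hs

variable {V W : Type*} [Fintype V] [Fintype W]

open Classical in
/-- If `x` is the largest zero among the polynomials of all subsets, a minimal subset `S` with a
zero at `x` is everything: otherwise connectedness gives an edge from some `w ∉ S` to `S`, and the
recurrence at `w` makes the polynomial of `insert w S` negative at `x`. -/
theorem Connected.exists_isRoot_forall_pos {G : SimpleGraph V} (hG : G.Connected) (a : V → ℝ) :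
    ∃ x₁, (G.weightedMatchingPolynomial a Finset.univ).IsRoot x₁ ∧
      (∀ x, x₁ < x → ∀ S, 0 < (G.weightedMatchingPolynomial a S).eval x) ∧
      ∀ S, S ≠ Finset.univ → 0 < (G.weightedMatchingPolynomial a S).eval x₁ := by
  set P := G.weightedMatchingPolynomial a with hP
  have hne : ∀ S, P S ≠ 0 := fun S => (G.weightedMatchingPolynomial_monic a S).ne_zero
  set R : Finset ℝ := Finset.univ.biUnion fun S => (P S).roots.toFinset with hR
  have hmem : ∀ {x S}, (P S).IsRoot x → x ∈ R := fun {x S} hx =>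
    Finset.mem_biUnion.2 ⟨S, Finset.mem_univ _, by simpa [hne S] using hx⟩
  have hRne : R.Nonempty := by
    obtain ⟨v⟩ := hG.nonempty
    refine ⟨a v, hmem (S := {v}) ?_⟩
    rw [hP, weightedMatchingPolynomial_recurrence G a (Finset.mem_singleton_self v)]
    simp
  obtain ⟨x₁, hx₁, hmax⟩ : ∃ x₁ ∈ R, ∀ x ∈ R, x ≤ x₁ :=
    ⟨R.max' hRne, R.max'_mem hRne, fun x hx => R.le_max' x hx⟩
  have hpos : ∀ x, x₁ < x → ∀ S, 0 < (P S).eval x := by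
    intro x hx S
    by_contra! hle
    -- A monic polynomial that is not positive at `x` has a zero beyond `x`.
    have htend : ∃ y, x ≤ y ∧ 0 ≤ (P S).eval y := by
      rcases S.eq_empty_or_nonempty with rfl | hS
      · exact ⟨x, le_rfl, by simp [hP]⟩
      · have hdeg : 0 < (P S).degree := by
          rw [← natDegree_pos_iff_degree_pos, hP, natDegree_weightedMatchingPolynomial]
          exact hS.card_pos
        have ht := (P S).tendsto_atTop_of_leadingCoeff_nonneg hdeg
          (by rw [(G.weightedMatchingPolynomial_monic a S).leadingCoeff]; exact zero_le_one)
        obtain ⟨y, h1, h2⟩ := ((ht.eventually_ge_atTop 0).and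
          (Filter.eventually_ge_atTop x)).exists
        exact ⟨y, h2, h1⟩
    obtain ⟨y, hxy, hy⟩ := htend
    obtain ⟨c, hc, hc0⟩ := intermediate_value_Icc hxy (P S).continuous.continuousOn ⟨hle, hy⟩
    exact (hx.trans_le hc.1).not_ge (hmax c (hmem hc0))
  have hnonneg : ∀ S, 0 ≤ (P S).eval x₁ := by
    intro S
    have := ((P S).continuous.continuousAt (x := x₁)).tendsto.mono_left
      (nhdsWithin_le_nhds (s := Set.Ioi x₁))
    refine ge_of_tendsto this ?_
    filter_upwards [self_mem_nhdsWithin] with x hx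
    exact (hpos x hx S).le
  obtain ⟨S₀, hS₀⟩ : ∃ S, (P S).eval x₁ = 0 := by
    obtain ⟨S, -, hS⟩ := Finset.mem_biUnion.1 hx₁
    exact ⟨S, (mem_roots'.1 (Multiset.mem_toFinset.1 hS)).2⟩
  have huniv : ∀ S, (P S).eval x₁ = 0 → S = Finset.univ := by
    intro S
    induction S using Finset.strongInduction with
    | H S ih =>
      intro hS
      by_contra hSV
      have hSne : S.Nonempty := by
        rw [Finset.nonempty_iff_ne_empty]
        rintro rfl
        simp [hP] at hS
      obtain ⟨u, hu, w, hw, huw⟩ : ∃ u ∈ S, ∃ w, w ∉ S ∧ G.Adj u w := by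
        obtain ⟨u₀, hu₀⟩ := hSne
        obtain ⟨w₀, hw₀⟩ : ∃ w, w ∉ S := by
          by_contra! hall
          exact hSV (Finset.eq_univ_iff_forall.2 hall)
        obtain ⟨p⟩ := hG.preconnected u₀ w₀
        obtain ⟨d, -, hd1, hd2⟩ := p.exists_boundary_dart (S : Set V) hu₀ hw₀
        exact ⟨d.fst, hd1, d.snd, hd2, d.adj⟩
      have hrec := congrArg (eval x₁)
        (weightedMatchingPolynomial_recurrence G a (Finset.mem_insert_self w S))
      rw [Finset.erase_insert hw, ← hP, eval_sub, eval_mul, hS, mul_zero, zero_sub,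
        eval_finsetSum] at hrec
      have hsum : 0 < ∑ u ∈ S with G.Adj w u, (P (S.erase u)).eval x₁ := by
        refine Finset.sum_pos (fun t ht => ?_) ⟨u, Finset.mem_filter.2 ⟨hu, huw.symm⟩⟩
        refine lt_of_le_of_ne (hnonneg _) fun h0 => ?_
        have htS := (Finset.mem_filter.1 ht).1
        have := ih _ (Finset.erase_ssubset htS) h0.symm
        exact Finset.notMem_erase t S (this ▸ Finset.mem_univ t)
      linarith [hnonneg (insert w S)]
  refine ⟨x₁, ?_, hpos, fun S hS => lt_of_le_of_ne (hnonneg S) fun h0 => hS (huniv S h0.symm)⟩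
  rw [← huniv S₀ hS₀]
  exact hS₀

open Classical in
/-- Quotients of consecutive polynomials do not decrease when vertices and edges are deleted and
the weights are lowered, and they grow by at least the change of the weight at the vertex removed
in the denominator. Positivity is only required on proper subsets. -/
theorem div_add_weight_sub_le_div {G : SimpleGraph V} {H : SimpleGraph W} (f : W ↪ V)
    (hf : ∀ u w, H.Adj u w → G.Adj (f u) (f w)) {a : V → ℝ} {b : W → ℝ}
    (hab : ∀ w, b w ≤ a (f w)) {x : ℝ} (S : Finset W)
    (hpos : ∀ T, T ⊂ S.map f → 0 < (G.weightedMatchingPolynomial a T).eval x) :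
    ∀ v ∈ S, 0 < (H.weightedMatchingPolynomial b (S.erase v)).eval x ∧
      (G.weightedMatchingPolynomial a (S.map f)).eval x /
          (G.weightedMatchingPolynomial a ((S.erase v).map f)).eval x + (a (f v) - b v) ≤
        (H.weightedMatchingPolynomial b S).eval x /
          (H.weightedMatchingPolynomial b (S.erase v)).eval x := by
  induction S using Finset.strongInduction with
  | H S ih =>
    intro v hv
    have hss : (S.erase v).map f ⊂ S.map f := Finset.map_ssubset_map.2 (Finset.erase_ssubset hv)
    have ih' := ih _ (Finset.erase_ssubset hv) fun T hT => hpos T (hT.trans hss)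
    have hGpos := hpos _ hss
    have hGpos' : ∀ u ∈ S.erase v,
        0 < (G.weightedMatchingPolynomial a (((S.erase v).erase u).map f)).eval x := fun u hu =>
      hpos _ ((Finset.map_ssubset_map.2 (Finset.erase_ssubset hu)).trans hss)
    have hle : ∀ u ∈ S.erase v, (G.weightedMatchingPolynomial a ((S.erase v).map f)).eval x /
          (G.weightedMatchingPolynomial a (((S.erase v).erase u).map f)).eval x ≤
        (H.weightedMatchingPolynomial b (S.erase v)).eval x /
          (H.weightedMatchingPolynomial b ((S.erase v).erase u)).eval x := fun u hu => by
      linarith [(ih' u hu).2, hab u]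
    have hHpos : 0 < (H.weightedMatchingPolynomial b (S.erase v)).eval x := by
      rcases (S.erase v).eq_empty_or_nonempty with h0 | ⟨u, hu⟩
      · simp [h0]
      · have := (div_pos hGpos (hGpos' u hu)).trans_le (hle u hu)
        exact (div_pos_iff_of_pos_right (ih' u hu).1).1 this
    refine ⟨hHpos, ?_⟩
    have hfv : f v ∈ S.map f := Finset.mem_map_of_mem f hv
    rw [weightedMatchingPolynomial_recurrence G a hfv, ← Finset.map_erase,
      weightedMatchingPolynomial_recurrence H b hv, eval_sub, eval_sub, eval_mul, eval_mul,
      sub_div, sub_div, mul_div_cancel_right₀ _ hGpos.ne', mul_div_cancel_right₀ _ hHpos.ne',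
      eval_finsetSum, eval_finsetSum, Finset.sum_div, Finset.sum_div, Finset.sum_filter,
      Finset.sum_filter, Finset.sum_map]
    have hsum : (∑ u ∈ S.erase v, if H.Adj v u then
          (H.weightedMatchingPolynomial b ((S.erase v).erase u)).eval x /
            (H.weightedMatchingPolynomial b (S.erase v)).eval x else 0) ≤
        ∑ u ∈ S.erase v, if G.Adj (f v) (f u) then
          (G.weightedMatchingPolynomial a (((S.erase v).map f).erase (f u))).eval x /
            (G.weightedMatchingPolynomial a ((S.erase v).map f)).eval x else 0 := by
      refine Finset.sum_le_sum fun u hu => ?_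
      rw [← Finset.map_erase]
      have hG0 := div_pos (hGpos' u hu) hGpos
      by_cases hadj : H.Adj v u
      · rw [if_pos hadj, if_pos (hf _ _ hadj), ← inv_div,
          ← inv_div ((G.weightedMatchingPolynomial a ((S.erase v).map f)).eval x)]
        exact inv_anti₀ (div_pos hGpos (hGpos' u hu)) (hle u hu)
      · rw [if_neg hadj]
        split_ifs
        exacts [hG0.le, le_rfl]
    simp only [eval_sub, eval_X, eval_C]
    linarith

/-- If the quotient of `G` at `v` is positive, or nonnegative with a smaller weight on `v` in `H`,
then the quotient of `H` at `v` is positive. -/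
theorem eval_weightedMatchingPolynomial_pos_of_embedding {G : SimpleGraph V} {H : SimpleGraph W}
    (f : W ↪ V) (hf : ∀ u w, H.Adj u w → G.Adj (f u) (f w)) {a : V → ℝ} {b : W → ℝ}
    (hab : ∀ w, b w ≤ a (f w)) {x : ℝ}
    (hpos : ∀ T, T ⊂ Finset.univ.map f → 0 < (G.weightedMatchingPolynomial a T).eval x)
    (hnonneg : 0 ≤ (G.weightedMatchingPolynomial a (Finset.univ.map f)).eval x) (v : W)
    (hv : 0 < (G.weightedMatchingPolynomial a (Finset.univ.map f)).eval x ∨ b v < a (f v)) :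
    0 < (H.weightedMatchingPolynomial b Finset.univ).eval x := by
  classical
  obtain ⟨h1, h2⟩ := div_add_weight_sub_le_div f hf hab Finset.univ hpos v (Finset.mem_univ v)
  have hden := hpos _ (Finset.map_ssubset_map.2 (Finset.erase_ssubset (Finset.mem_univ v)))
  refine (div_pos_iff_of_pos_right h1).1 (lt_of_lt_of_le ?_ h2)
  rcases hv with hv | hv
  · exact add_pos_of_pos_of_nonneg (div_pos hv hden) (sub_nonneg.2 (hab v))
  · exact add_pos_of_nonneg_of_pos (div_nonneg hnonneg hden.le) (sub_pos.2 hv)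

open Classical in
/-- If the whole vertex set is kept, then some vertex loses an edge, so that its weight drops and
positivity of the large polynomial itself is not needed. -/
theorem eval_laplacianMatchingPolynomial_coe_pos {G : SimpleGraph V} (H : G.Subgraph)
    [Fintype H.verts] (hH : H ≠ ⊤) (hne : H.verts.Nonempty) {x : ℝ}
    (h0 : 0 ≤ (G.weightedMatchingPolynomial (fun v => (G.degree v : ℝ)) Finset.univ).eval x)
    (hpos : ∀ S, S ≠ Finset.univ →
      0 < (G.weightedMatchingPolynomial (fun v => (G.degree v : ℝ)) S).eval x) :
    0 < H.coe.laplacianMatchingPolynomial.eval x := by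
  let f : H.verts ↪ V := Function.Embedding.subtype (· ∈ H.verts)
  suffices ∃ v : H.verts, 0 < (G.weightedMatchingPolynomial (fun v => (G.degree v : ℝ))
      (Finset.univ.map f)).eval x ∨ ∃ w, G.Adj v w ∧ ¬ H.Adj v w by
    obtain ⟨v, hv⟩ := this
    rw [laplacianMatchingPolynomial_eq]
    refine eval_weightedMatchingPolynomial_pos_of_embedding f (fun u w h => H.coe_adj_sub u w h)
      (fun w => ?_) (fun T hT => hpos T (hT.trans_subset (Finset.subset_univ _)).ne) ?_ v
      (hv.imp_right fun ⟨w, hG, hH⟩ => ?_)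
    · rw [H.coe_degree]
      exact_mod_cast H.degree_le w
    · by_cases hV : Finset.univ.map f = Finset.univ
      · rwa [hV]
      · exact (hpos _ hV).le
    · rw [H.coe_degree]
      exact_mod_cast H.degree_lt_of_adj_of_not_adj hG hH
  by_cases hV : Finset.univ.map f = Finset.univ
  · have hverts : ∀ v, v ∈ H.verts := fun v => by
      obtain ⟨w, -, rfl⟩ := Finset.mem_map.1 (hV ▸ Finset.mem_univ v : v ∈ Finset.univ.map f)
      exact w.2
    obtain ⟨u, w, huw, hHuw⟩ : ∃ u w, G.Adj u w ∧ ¬ H.Adj u w := by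
      by_contra! hall
      refine hH (Subgraph.ext (Set.eq_univ_of_forall hverts) ?_)
      funext u w
      exact propext ⟨fun h => H.adj_sub h, fun h => hall u w h⟩
    exact ⟨⟨u, hverts u⟩, Or.inr ⟨w, huw, hHuw⟩⟩
  · obtain ⟨v, hv⟩ := hne
    exact ⟨⟨v, hv⟩, Or.inl (hpos _ hV)⟩

end SimpleGraph

theorem mainTheorem3 {V : Type*} [Fintype V] (G : SimpleGraph V) :
    (∀ e ∈ G.edgeSet, ∃ α β : Fin (Fintype.card V) → ℝ,
      G.laplacianMatchingPolynomial.IsOrderedZeros α ∧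
      (G.deleteEdges {e}).laplacianMatchingPolynomial.IsOrderedZeros β ∧
      (∀ i, β i ≤ α i) ∧
      (∀ i j : Fin (Fintype.card V), (i : ℕ) + 1 = (j : ℕ) → α i ≤ β j)) ∧
    (G.Connected → ∀ (H : G.Subgraph) [Fintype H.verts], H ≠ ⊤ → H.verts.Nonempty →
      ∃ a b : ℝ,
        G.laplacianMatchingPolynomial.IsLargestZero a ∧
        H.coe.laplacianMatchingPolynomial.IsLargestZero b ∧
        b < a) := by
  classical
  constructor
  · intro e he
    obtain ⟨α, hα, hα'⟩ := G.laplacianMatchingPolynomial_monic.exists_isOrderedZeros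
      G.laplacianMatchingPolynomial_splits G.natDegree_laplacianMatchingPolynomial
    obtain ⟨β, hβ, hβ'⟩ := Polynomial.Monic.exists_isOrderedZeros
      (G.deleteEdges {e}).laplacianMatchingPolynomial_monic
      (G.deleteEdges {e}).laplacianMatchingPolynomial_splits
      (G.deleteEdges {e}).natDegree_laplacianMatchingPolynomial
    refine ⟨α, β, hα, hβ, interlacing_of_div_im_pos hα.2.1 hβ.2.1 fun z hz => ?_⟩
    rw [← hα', ← hβ']
    exact G.laplacianMatchingPolynomial_div_deleteEdges_im_pos he hz
  · intro hG H _ hH hne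
    -- All polynomials of proper subsets are positive from the largest zero `a` of `G` on.
    obtain ⟨a, hroot, hgt, hproper⟩ := hG.exists_isRoot_forall_pos fun v => (G.degree v : ℝ)
    have hHpos : ∀ x, a ≤ x → 0 < H.coe.laplacianMatchingPolynomial.eval x := by
      intro x hx
      rcases hx.eq_or_lt with rfl | hx
      · exact SimpleGraph.eval_laplacianMatchingPolynomial_coe_pos H hH hne hroot.ge hproper
      · exact SimpleGraph.eval_laplacianMatchingPolynomial_coe_pos H hH hne (hgt x hx _).le
          fun S _ => hgt x hx S
    have hne0 := H.coe.laplacianMatchingPolynomial_monic.ne_zero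
    have hRne : H.coe.laplacianMatchingPolynomial.roots.toFinset.Nonempty := by
      have hdeg : H.coe.laplacianMatchingPolynomial.natDegree ≠ 0 := by
        rw [H.coe.natDegree_laplacianMatchingPolynomial]
        exact (Fintype.card_pos_iff.2 hne.to_subtype).ne'
      simpa [Multiset.toFinset_nonempty] using
        H.coe.laplacianMatchingPolynomial_splits.roots_ne_zero hdeg
    set R := H.coe.laplacianMatchingPolynomial.roots.toFinset with hR
    have hmem : ∀ x, x ∈ R ↔ H.coe.laplacianMatchingPolynomial.IsRoot x := fun x => by
      rw [hR, Multiset.mem_toFinset, mem_roots hne0]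
    refine ⟨a, R.max' hRne, ⟨G.laplacianMatchingPolynomial_monic.ne_zero,
      G.laplacianMatchingPolynomial_splits, ?_, fun x hx => ?_⟩, ⟨hne0,
      H.coe.laplacianMatchingPolynomial_splits, (hmem _).1 (R.max'_mem hRne), fun x hx =>
        R.le_max' x ((hmem x).2 hx)⟩, ?_⟩
    · rw [Set.mem_ofPred_eq, SimpleGraph.laplacianMatchingPolynomial_eq]
      exact hroot
    · rw [Set.mem_ofPred_eq, SimpleGraph.laplacianMatchingPolynomial_eq] at hx
      by_contra! hlt
      exact (hgt x hlt Finset.univ).ne' hx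
    · by_contra! hle
      exact (hHpos _ hle).ne' ((hmem _).1 (R.max'_mem hRne))
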